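/- For a finite graph $G$ and an integer $r\ge 2$, let $\mathrm{tc}_r(G)$ (the $r$-color tree-cover number) be the minimum $s$ such that for every coloring of the edges of $G$ with $r$ colors there are monochromatic connected subgraphs $H_1,\dots,H_t$ of $G$ with $t\le s$ and $V(H_1)\cup\dots\cup V(H_t)=V(G)$ (a single vertex counts as a monochromatic connected subgraph). Let $G(n,p)$ be the binomial random graph on $n$ vertices in which each pair is an edge independently with probability $p$, and let $\log$ be the natural logarithm. **Theorem 1.5.** Let $r\ge 2$ and let $p=p(n)\in[0,1]$. 1. If, for all sufficiently large $n$, $p=\left(\frac{r\log n-\omega(n)}{n}\right)^{1/r}$, where $\omega(n)\to\infty$ as $n\to\infty$ and $\omega(n)\le r\log n$ for all sufficiently large $n$, then $\lim_{n\to\infty}\Pr\left[\mathrm{tc}_r(G(n,p))>r\right]=1$. 2. If $p=o\left(\left(\frac{r\log n}{n}\right)^{1/r}\right)$ as $n\to\infty$, then $\mathrm{tc}_r(G(n,p))\to\infty$ asymptotically almost surely, i.e. for every fixed integer $K\geq 0$, $\lim_{n\to\infty}\Pr\left[\mathrm{tc}_r(G(n,p))>K\right]=1$. -/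

import Mathlib

namespace SimpleGraph

variable {V : Type*}

/-- A subgraph `H` of an edge-coloured graph `G` is monochromatic if all its edges have one common
colour. (A subgraph without edges is monochromatic as soon as there is a colour.) -/
def Subgraph.IsMonochromatic {G : SimpleGraph V} {K : Type*} (χ : G.EdgeLabeling K)
    (H : G.Subgraph) : Prop :=
  ∃ c : K, ∀ (e : Sym2 V) (he : e ∈ H.edgeSet), χ ⟨e, H.edgeSet_subset he⟩ = c

/-- The edge-coloured graph `(G, χ)` has a cover by at most `s` monochromatic connected subgraphs
`H₁, …, H_t`: their vertex sets cover `V(G)`. (`Subgraph.Connected` includes nonemptiness.) -/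
def HasMonochromaticCover (G : SimpleGraph V) {K : Type*} (χ : G.EdgeLabeling K) (s : ℕ) : Prop :=
  ∃ t ≤ s, ∃ H : Fin t → G.Subgraph,
    (∀ i, (H i).Connected ∧ (H i).IsMonochromatic χ) ∧ ⋃ i, (H i).verts = Set.univ

/-- The `r`-colour tree-cover number `tc_r(G)` of a finite graph: the minimum `s` such that for
every `r`-edge-colouring of `G` the vertices can be covered by at most `s` monochromatic connected
subgraphs. -/
noncomputable def treeCoverNumber (r : ℕ) (G : SimpleGraph V) : ℕ :=
  sInf {s : ℕ | ∀ χ : G.EdgeLabeling (Fin r), G.HasMonochromaticCover χ s}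

/-- In a finite graph (with at least one colour) the single vertices form a cover, so the minimum
defining the tree-cover number is over a nonempty set. -/
theorem hasMonochromaticCover_card [Finite V] (G : SimpleGraph V) {K : Type*} [Nonempty K]
    (χ : G.EdgeLabeling K) : G.HasMonochromaticCover χ (Nat.card V) := by
  refine ⟨Nat.card V, le_rfl, fun i => G.singletonSubgraph ((Finite.equivFin V).symm i),
    fun i => ⟨Subgraph.singletonSubgraph_connected, Classical.arbitrary K, fun e he => ?_⟩, ?_⟩
  · simp at he
  · ext v
    simp only [Set.mem_iUnion, Set.mem_univ, iff_true]
    exact ⟨Finite.equivFin V v, by simp⟩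

/-- `tc_r(G)` is a genuine minimum for finite graphs and `r ≥ 1`. -/
theorem treeCoverNumber_le_iff [Finite V] {r : ℕ} (hr : 1 ≤ r) (G : SimpleGraph V) (s : ℕ) :
    treeCoverNumber r G ≤ s ↔ ∀ χ : G.EdgeLabeling (Fin r), G.HasMonochromaticCover χ s := by
  have : Nonempty (Fin r) := ⟨⟨0, hr⟩⟩
  have hne : {s : ℕ | ∀ χ : G.EdgeLabeling (Fin r), G.HasMonochromaticCover χ s}.Nonempty :=
    ⟨Nat.card V, fun χ => G.hasMonochromaticCover_card χ⟩
  refine ⟨fun h χ => ?_, fun h => Nat.sInf_le h⟩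
  obtain ⟨t, ht, H⟩ := Nat.sInf_mem hne χ
  exact ⟨t, ht.trans h, H⟩

end SimpleGraph

/-! A k-set X is an obstruction to covering by k monochromatic connected subgraphs if X is
independent, every outside vertex has fewer than r neighbours in X, and some outside vertex w has
none. Colour the edges from each outside vertex to X injectively with the first r - 1 colours, and
all other edges with the last colour. A monochromatic connected subgraph through x ∈ X then stays in
the closed neighbourhood of x, so it contains no other vertex of X and not w
(`card_lt_treeCoverNumber`).

Obstructions are found by the second moment method (`real_compl_biUnion_le_of_pairwise`) over a
family of M sets of size k that pairwise share fewer than r vertices. Write g for the probability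
that a vertex has fewer than r neighbours in X. Each set is an obstruction with probability about
g^n. Two of them are nearly independent if n p^(r+1) → 0: having r neighbours in both sets forces r
+ 1 edges at one vertex (`real_fewNeighbors_inter_le`). So M g^n → ∞ suffices
(`tendsto_real_lt_treeCoverNumber`).

For the sharp threshold take k = r and all r-sets avoiding w: M is of order n^r and g^n = (1 -
p^r)^n is about e^ω / n^r. Below the threshold order take k arbitrary and disjoint blocks: M is
about n / k, while g^n ≥ n^(-1/2). -/

namespace SimpleGraph

/-! ### The colouring obstruction. -/

open Classical in
/-- If every vertex outside `X` has fewer than `r` neighbours in the independent set `X`, and some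
vertex outside `X` has none, then some `r`-colouring needs more than `|X|` monochromatic connected
subgraphs to cover all vertices. -/
theorem card_lt_treeCoverNumber {V : Type*} [Finite V] {r : ℕ} (hr : 2 ≤ r) (G : SimpleGraph V)
    (X : Finset V) (w : V) (hw : w ∉ X)
    (hdeg : ∀ v ∉ X, {x ∈ X | G.Adj v x}.card < r)
    (hind : ∀ v ∈ insert w X, ∀ x ∈ X, ¬ G.Adj v x) :
    X.card < treeCoverNumber r G := by
  by_contra! hle
  rw [treeCoverNumber_le_iff (by omega)] at hle
  let last : Fin r := ⟨r - 1, by omega⟩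
  obtain ⟨c, hinj, hlast⟩ : ∃ c : V → V → Fin r,
      (∀ v ∉ X, ∀ x ∈ X, ∀ y ∈ X, G.Adj v x → G.Adj v y → c v x = c v y → x = y) ∧
      (∀ v ∉ X, ∀ x ∈ X, G.Adj v x → c v x ≠ last) := by
    have h (v : V) (hv : v ∉ X) : ∃ f : V → Fin r,
        (∀ x ∈ X, ∀ y ∈ X, G.Adj v x → G.Adj v y → f x = f y → x = y) ∧
        (∀ x ∈ X, G.Adj v x → f x ≠ last) := by
      have hc := hdeg v hv
      set N := {x ∈ X | G.Adj v x} with hN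
      -- Indices run up to `N.card - 1`, at most r - 2, so `last` is never used on an edge to X; the
      -- value off `N` is irrelevant.
      refine ⟨fun x => if h : x ∈ N then ⟨N.equivFin ⟨x, h⟩, by omega⟩ else last, ?_, ?_⟩
      · intro x hx y hy hvx hvy hxy
        have hx' : x ∈ N := by simp [hN, hx, hvx]
        have hy' : y ∈ N := by simp [hN, hy, hvy]
        simp only [hx', hy', dite_true, Fin.mk.injEq] at hxy
        simpa using N.equivFin.injective (Fin.ext hxy)
      · intro x hx hvx
        have hx' : x ∈ N := by simp [hN, hx, hvx]
        have := (N.equivFin ⟨x, hx'⟩).isLt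
        simp only [hx', dite_true, last, ne_eq, Fin.mk.injEq]
        omega
    have : Nonempty (Fin r) := ⟨last⟩
    choose! c hc using h
    exact ⟨c, fun v hv => (hc v hv).1, fun v hv => (hc v hv).2⟩
  let χ : G.EdgeLabeling (Fin r) := EdgeLabeling.mk
    (fun u v _ => if u ∈ X then (if v ∈ X then last else c v u)
      else if v ∈ X then c u v else last)
    (fun u v _ => by by_cases hu : u ∈ X <;> by_cases hv : v ∈ X <;> simp [hu, hv])
  have hχ (v x : V) (h : G.Adj v x) (hv : v ∉ X) (hx : x ∈ X) : χ ⟨s(v, x), h⟩ = c v x := by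
    change χ.get v x h = _
    simp [χ, EdgeLabeling.get_mk, hv, hx]
  have hχ' (v u : V) (h : G.Adj v u) (hv : v ∉ X) (hu : u ∉ X) : χ ⟨s(v, u), h⟩ = last := by
    change χ.get v u h = _
    simp [χ, EdgeLabeling.get_mk, hv, hu]
  -- From x the subgraph reaches only some u ∉ X, along a colour other than `last`; the only edge of
  -- that colour at u leads back to x. Hence being x or adjacent to x in H is invariant along walks.
  have key (H : G.Subgraph) (hc : H.Connected) (hm : H.IsMonochromatic χ) (x : V) (hx : x ∈ X)
      (hxH : x ∈ H.verts) : ∀ y ∈ H.verts, y = x ∨ G.Adj y x := by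
    obtain ⟨k, hk⟩ := hm
    have hk' (u v : V) (h : H.Adj u v) : χ ⟨s(u, v), h.adj_sub⟩ = k := hk s(u, v) h
    have step (u v : V) (hu : u = x ∨ H.Adj u x) (huv : H.Adj u v) : v = x ∨ H.Adj v x := by
      rcases hu with rfl | hu
      · exact Or.inr huv.symm
      · left
        have huX : u ∉ X := fun h => hind u (Finset.mem_insert_of_mem h) x hx hu.adj_sub
        have h1 := hk' u x hu
        rw [hχ u x hu.adj_sub huX hx] at h1
        have h2 := hk' u v huv
        by_cases hvX : v ∈ X
        · rw [hχ u v huv.adj_sub huX hvX] at h2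
          exact hinj u huX v hvX x hx huv.adj_sub hu.adj_sub (h2.trans h1.symm)
        · rw [hχ' u v huv.adj_sub huX hvX] at h2
          exact absurd (h1.trans h2.symm) (hlast u huX x hx hu.adj_sub)
    intro y hy
    obtain ⟨W⟩ := hc.coe.preconnected ⟨x, hxH⟩ ⟨y, hy⟩
    have walk : ∀ (a b : H.verts) (W : H.coe.Walk a b), ((a : V) = x ∨ H.Adj a x) →
        ((b : V) = x ∨ H.Adj b x) := by
      intro a b W
      induction W with
      | nil => exact id
      | cons h _ ih => exact fun ha => ih (step _ _ ha h)
    exact (walk _ _ W (Or.inl rfl)).imp id fun h => h.adj_sub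
  obtain ⟨t, ht, H, hH, hcov⟩ := hle χ
  have hmem (v : V) : ∃ i, v ∈ (H i).verts := by
    simpa using (hcov.symm ▸ Set.mem_univ v : v ∈ ⋃ i, (H i).verts)
  choose f hf using hmem
  have hfinj : Set.InjOn f X := by
    intro x hx y hy hxy
    have := key _ (hH (f x)).1 (hH (f x)).2 x hx (hf x) y (by rw [hxy]; exact hf y)
    rcases this with h | h
    · exact h.symm
    · exact absurd h (hind y (Finset.mem_insert_of_mem hy) x hx)
  -- At most |X| subgraphs already receive distinct elements of X, so each of them contains one; the
  -- subgraph covering w gives the contradiction.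
  have hsurj : X.image f = Finset.univ := by
    refine Finset.eq_univ_of_card _ (le_antisymm (Finset.card_le_univ _) ?_)
    rw [Finset.card_image_of_injOn hfinj]
    simpa using ht
  obtain ⟨x, hx, hxw⟩ := Finset.mem_image.1 (hsurj ▸ Finset.mem_univ (f w))
  rcases key _ (hH (f x)).1 (hH (f x)).2 x hx (hf x) w (by rw [hxw]; exact hf w) with h | h
  · exact hw (h ▸ hx)
  · exact hind w (Finset.mem_insert_self _ _) x hx h

/-! ### Independence of edges in the binomial random graph. -/

section

open MeasureTheory ProbabilityTheory unitInterval

variable {V : Type*} [Finite V]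

theorem measurableSet_of_finite (s : Set (SimpleGraph V)) : MeasurableSet s := by
  have h : MeasurableSet (edgeSet '' s) := (Set.toFinite _).measurableSet
  rw [← Set.preimage_image_eq s edgeSet_injective]
  exact measurable_edgeSet h

theorem binomialRandom_eq_map_infinitePi (p : I) :
    binomialRandom V p = (Measure.infinitePi fun e : Sym2 V =>
      toNNReal p • Measure.dirac (e ∈ Sym2.diagSetᶜ) + toNNReal (σ p) • Measure.dirac False).map
        (fun a : Sym2 V → Prop => fromEdgeSet {e | a e}) := by
  rw [binomialRandom_eq_map, setBernoulli_eq_map, Measure.map_map (by fun_prop) (by fun_prop)]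
  rfl

/-- Each edge indicator is a function of its own coordinate of a product measure. The conjunct `¬
e.IsDiag` mirrors the removal of loops by `fromEdgeSet`. -/
theorem iIndepFun_mem_edgeSet (p : I) :
    iIndepFun (fun (e : Sym2 V) (G : SimpleGraph V) => e ∈ G.edgeSet) (binomialRandom V p) := by
  rw [binomialRandom_eq_map_infinitePi, iIndepFun_iff_measure_inter_preimage_eq_mul]
  intro S sets hsets
  have h := iIndepFun_iff_measure_inter_preimage_eq_mul.1 (iIndepFun_infinitePi
    (P := fun e : Sym2 V => toNNReal p • Measure.dirac (e ∈ Sym2.diagSetᶜ) +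
      toNNReal (σ p) • Measure.dirac False)
    (X := fun (e : Sym2 V) (a : Prop) => a ∧ ¬ e.IsDiag) (fun e => by fun_prop)) S hsets
  have hpre (t : Set (SimpleGraph V)) := Measure.map_apply
    (μ := Measure.infinitePi fun e : Sym2 V => toNNReal p • Measure.dirac (e ∈ Sym2.diagSetᶜ) +
      toNNReal (σ p) • Measure.dirac False)
    (f := fun a : Sym2 V → Prop => fromEdgeSet {e | a e}) (by fun_prop)
    (measurableSet_of_finite t)
  simp only [hpre, Set.preimage_iInter, ← Set.preimage_comp, Function.comp_def, edgeSet_fromEdgeSet,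
    Set.mem_sdiff, Set.mem_ofPred_eq, Sym2.mem_diagSet]
  exact h

theorem binomialRandom_real_mem_edgeSet (p : I) {e : Sym2 V} (he : ¬ e.IsDiag) :
    (binomialRandom V p).real {G | e ∈ G.edgeSet} = p := by
  rw [binomialRandom_eq_map_infinitePi, measureReal_def,
    Measure.map_apply (by fun_prop) (measurableSet_of_finite _)]
  have h1 : (fun a : Sym2 V → Prop => fromEdgeSet {e | a e}) ⁻¹' {G | e ∈ G.edgeSet} =
      (fun a : Sym2 V → Prop => a e) ⁻¹' {True} := by
    ext a
    simp [he]
  rw [h1, ← Measure.map_apply (by fun_prop) (MeasurableSet.of_discrete), Measure.infinitePi_map_eval]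
  simp [he]

/-- Membership of a graph in `E` depends only on which elements of `S` are edges. -/
def DependsOnEdges (E : Set (SimpleGraph V)) (S : Finset (Sym2 V)) : Prop :=
  ∀ G G' : SimpleGraph V, (∀ e ∈ S, e ∈ G.edgeSet ↔ e ∈ G'.edgeSet) → (G ∈ E ↔ G' ∈ E)

/-- An event depending only on S is the preimage of its own image under restriction to S, so
independence of disjoint blocks of coordinates applies. -/
theorem DependsOnEdges.real_inter {E F : Set (SimpleGraph V)} {S T : Finset (Sym2 V)}
    (hE : DependsOnEdges E S) (hF : DependsOnEdges F T) (h : Disjoint S T) (p : I) :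
    (binomialRandom V p).real (E ∩ F) =
      (binomialRandom V p).real E * (binomialRandom V p).real F := by
  have hm : ∀ e : Sym2 V, Measurable fun G : SimpleGraph V => e ∈ G.edgeSet := fun e =>
    measurable_set_iff.1 measurable_edgeSet e
  have hi := (iIndepFun_mem_edgeSet p).indepFun_finset S T h hm
  have aux {E : Set (SimpleGraph V)} {S : Finset (Sym2 V)} (hE : DependsOnEdges E S) :
      (fun (G : SimpleGraph V) (i : S) => (i : Sym2 V) ∈ G.edgeSet) ⁻¹'
        ((fun (G : SimpleGraph V) (i : S) => (i : Sym2 V) ∈ G.edgeSet) '' E) = E := by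
    ext G
    constructor
    · rintro ⟨G', hG', h⟩
      exact (hE G' G fun e he => iff_of_eq (congrFun h ⟨e, he⟩)).1 hG'
    · exact fun hG => ⟨G, hG, rfl⟩
  have := hi.measure_inter_preimage_eq_mul
    ((fun (G : SimpleGraph V) (i : S) => (i : Sym2 V) ∈ G.edgeSet) '' E)
    ((fun (G : SimpleGraph V) (i : T) => (i : Sym2 V) ∈ G.edgeSet) '' F)
    (Set.toFinite _).measurableSet (Set.toFinite _).measurableSet
  rw [aux hE, aux hF] at this
  rw [measureReal_def, this, ENNReal.toReal_mul, measureReal_def, measureReal_def]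

open Classical in
theorem real_biInter_of_dependsOnEdges {ι : Type*} (W : Finset ι) (E : ι → Set (SimpleGraph V))
    (S : ι → Finset (Sym2 V)) (hE : ∀ v ∈ W, DependsOnEdges (E v) (S v))
    (hS : (W : Set ι).PairwiseDisjoint S) (p : I) :
    (binomialRandom V p).real (⋂ v ∈ W, E v) = ∏ v ∈ W, (binomialRandom V p).real (E v) := by
  induction W using Finset.induction_on with
  | empty => simp
  | insert a W ha ih =>
    have hdep : DependsOnEdges (⋂ v ∈ W, E v) (W.biUnion S) := by
      intro G G' h
      simp only [Set.mem_iInter]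
      exact forall₂_congr fun v hv => hE v (Finset.mem_insert_of_mem hv) G G' fun e he =>
        h e (Finset.mem_biUnion.2 ⟨v, hv, he⟩)
    rw [Finset.set_biInter_insert, Finset.prod_insert ha, ← ih
      (fun v hv => hE v (Finset.mem_insert_of_mem hv))
      (hS.subset (by simp))]
    refine (hE a (Finset.mem_insert_self _ _)).real_inter hdep ?_ p
    rw [Finset.disjoint_biUnion_right]
    intro v hv
    exact hS (by simp) (by simp [hv]) (by rintro rfl; exact ha hv)

open Classical in
theorem real_edges_eq (p : I) (S T : Finset (Sym2 V)) (hST : T ⊆ S) (hd : ∀ e ∈ S, ¬ e.IsDiag) :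
    (binomialRandom V p).real {G | ∀ e ∈ S, e ∈ G.edgeSet ↔ e ∈ T} =
      (p : ℝ) ^ T.card * (1 - p : ℝ) ^ (S.card - T.card) := by
  have h1 : {G : SimpleGraph V | ∀ e ∈ S, e ∈ G.edgeSet ↔ e ∈ T} =
      ⋂ e ∈ S, {G | e ∈ G.edgeSet ↔ e ∈ T} := by ext; simp
  rw [h1, real_biInter_of_dependsOnEdges S _ (fun e => {e})]
  · have h2 : ∀ e ∈ S, (binomialRandom V p).real {G | e ∈ G.edgeSet ↔ e ∈ T} =
        if e ∈ T then (p : ℝ) else 1 - p := by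
      intro e he
      split_ifs with h
      · simpa [h] using binomialRandom_real_mem_edgeSet p (hd e he)
      · have := binomialRandom_real_mem_edgeSet p (hd e he)
        simp only [h, iff_false]
        rw [← this, ← probReal_compl_eq_one_sub (measurableSet_of_finite _)]
        rfl
    rw [Finset.prod_congr rfl h2, Finset.prod_ite, Finset.prod_const, Finset.prod_const,
      Finset.filter_mem_eq_inter, Finset.inter_eq_right.2 hST, Finset.filter_notMem_eq_sdiff,
      Finset.card_sdiff_of_subset hST]
  · intro e he G G' h
    have := h e (by simp)
    simp only [Set.mem_ofPred_eq, this]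
  · intro e he f hf hef
    simpa using hef

theorem real_subset_edgeSet (p : I) (T : Finset (Sym2 V)) (hd : ∀ e ∈ T, ¬ e.IsDiag) :
    (binomialRandom V p).real {G | ∀ e ∈ T, e ∈ G.edgeSet} = (p : ℝ) ^ T.card := by
  have := real_edges_eq p T T subset_rfl hd
  simp only [tsub_self, pow_zero, mul_one] at this
  rw [← this]
  congr 1
  ext G
  exact forall₂_congr fun e he => by simp [he]

theorem real_disjoint_edgeSet (p : I) (S : Finset (Sym2 V)) (hd : ∀ e ∈ S, ¬ e.IsDiag) :
    (binomialRandom V p).real {G | ∀ e ∈ S, e ∉ G.edgeSet} = (1 - p : ℝ) ^ S.card := by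
  simpa using real_edges_eq p S ∅ (by simp) hd

end

/-! ### The second moment method. -/

section

open MeasureTheory ProbabilityTheory unitInterval

/-- The second moment method, for a finite family of events whose pairwise correlations are
controlled. -/
theorem real_compl_biUnion_le_of_pairwise {Ω ι : Type*} [MeasurableSpace Ω] (P : Measure Ω)
    [IsProbabilityMeasure P] (F : Finset ι) (hF : F.Nonempty) (A : ι → Set Ω)
    (hA : ∀ i, MeasurableSet (A i)) {a b : ℝ} (ha : 0 < a) (hb : 0 ≤ b)
    (hlow : ∀ i ∈ F, a ≤ P.real (A i))
    (hpair : ∀ i ∈ F, ∀ j ∈ F, i ≠ j → P.real (A i ∩ A j) ≤ b) :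
    P.real (⋃ i ∈ F, A i)ᶜ ≤ 1 / (F.card * a) + (b / a ^ 2 - 1) := by
  classical
  set μ : ℝ := ∑ i ∈ F, P.real (A i) with hμ
  let N : Ω → ℝ := fun x => ∑ i ∈ F, (A i).indicator 1 x
  have hM : (0 : ℝ) < F.card := by exact_mod_cast hF.card_pos
  have hμa : F.card * a ≤ μ := by
    simpa [hμ] using Finset.card_nsmul_le_sum F _ a hlow
  have hμ0 : 0 < μ := (by positivity : 0 < F.card * a).trans_le hμa
  have hint (s : Set Ω) (hs : MeasurableSet s) : Integrable (s.indicator (1 : Ω → ℝ)) P :=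
    (integrable_const (1 : ℝ)).indicator hs
  have hN : Integrable N P := integrable_finsetSum _ fun i _ => hint _ (hA i)
  have hsq (x : Ω) : N x ^ 2 = ∑ i ∈ F, ∑ j ∈ F, (A i ∩ A j).indicator (1 : Ω → ℝ) x := by
    rw [sq, Finset.sum_mul_sum]
    refine Finset.sum_congr rfl fun i _ => Finset.sum_congr rfl fun j _ => ?_
    by_cases h1 : x ∈ A i <;> by_cases h2 : x ∈ A j <;> simp [h1, h2]
  have hN2 : Integrable (fun x => N x ^ 2) P := by
    simp only [hsq]
    exact integrable_finsetSum _ fun i _ => integrable_finsetSum _ fun j _ =>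
      hint _ ((hA i).inter (hA j))
  have hEN : ∫ x, N x ∂P = μ := by
    rw [integral_finsetSum _ fun i _ => hint _ (hA i)]
    exact Finset.sum_congr rfl fun i _ => integral_indicator_one (hA i)
  have hEN2 : ∫ x, N x ^ 2 ∂P ≤ μ + F.card ^ 2 * b := by
    simp only [hsq]
    rw [integral_finsetSum _ fun i _ => integrable_finsetSum _ fun j _ =>
      hint _ ((hA i).inter (hA j))]
    have h1 (i) (hi : i ∈ F) : ∫ x, ∑ j ∈ F, (A i ∩ A j).indicator (1 : Ω → ℝ) x ∂P ≤
        P.real (A i) + F.card * b := by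
      rw [integral_finsetSum _ fun j _ => hint _ ((hA i).inter (hA j))]
      -- The diagonal term is also charged b; this keeps the total at μ + M² b.
      calc _ ≤ ∑ j ∈ F, ((if i = j then P.real (A i) else 0) + b) := by
            refine Finset.sum_le_sum fun j hj => ?_
            rw [integral_indicator_one ((hA i).inter (hA j))]
            split_ifs with h
            · subst h
              simpa using hb
            · simpa using hpair i hi j hj h
        _ = _ := by simp [Finset.sum_add_distrib, hi]
    refine (Finset.sum_le_sum h1).trans (le_of_eq ?_)
    rw [Finset.sum_add_distrib]
    simp
    ring
  have hvar : ∫ x, (N x - μ) ^ 2 ∂P = ∫ x, N x ^ 2 ∂P - μ ^ 2 := by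
    have : (fun x => (N x - μ) ^ 2) = fun x => N x ^ 2 - (2 * μ * N x - μ ^ 2) := by
      ext x; ring
    have e1 : ∫ x, (N x ^ 2 - (2 * μ * N x - μ ^ 2)) ∂P =
        ∫ x, N x ^ 2 ∂P - ∫ x, (2 * μ * N x - μ ^ 2) ∂P :=
      integral_sub hN2 ((hN.const_mul _).sub (integrable_const _))
    have e2 : ∫ x, (2 * μ * N x - μ ^ 2) ∂P = ∫ x, 2 * μ * N x ∂P - ∫ _, μ ^ 2 ∂P :=
      integral_sub (hN.const_mul _) (integrable_const _)
    rw [this, e1, e2, integral_const_mul, hEN]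
    simp
    ring
  have hmeas : MeasurableSet (⋃ i ∈ F, A i)ᶜ :=
    (F.measurableSet_biUnion fun i _ => hA i).compl
  have hcheb : P.real (⋃ i ∈ F, A i)ᶜ * μ ^ 2 ≤ ∫ x, (N x - μ) ^ 2 ∂P := by
    have h1 : ∫ x, (⋃ i ∈ F, A i)ᶜ.indicator (fun _ => μ ^ 2) x ∂P =
        P.real (⋃ i ∈ F, A i)ᶜ * μ ^ 2 := by
      rw [integral_indicator_const _ hmeas, smul_eq_mul]
    rw [← h1]
    refine integral_mono ((integrable_const _).indicator hmeas) ?_ fun x => ?_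
    · have : (fun x => (N x - μ) ^ 2) = fun x => N x ^ 2 - (2 * μ * N x - μ ^ 2) := by
        ext x; ring
      rw [this]
      exact hN2.sub ((hN.const_mul _).sub (integrable_const _))
    · by_cases hx : x ∈ (⋃ i ∈ F, A i)ᶜ
      · have : N x = 0 := Finset.sum_eq_zero fun i hi => by
          have : x ∉ A i := fun h => hx (Set.mem_biUnion hi h)
          simp [this]
        simp only [Set.indicator_of_mem hx, this]
        exact le_of_eq (by ring)
      · simp only [Set.indicator_of_notMem hx]
        positivity
  have h3 : P.real (⋃ i ∈ F, A i)ᶜ ≤ (μ + F.card ^ 2 * b - μ ^ 2) / μ ^ 2 := by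
    rw [le_div_iff₀ (by positivity)]
    linarith
  have h4 : (μ + F.card ^ 2 * b - μ ^ 2) / μ ^ 2 = 1 / μ + (F.card ^ 2 * b / μ ^ 2 - 1) := by
    field_simp
    ring
  have h5 : F.card ^ 2 * b / μ ^ 2 ≤ b / a ^ 2 := by
    rw [div_le_div_iff₀ (by positivity) (by positivity)]
    have : (F.card * a) ^ 2 ≤ μ ^ 2 := by gcongr
    nlinarith
  have h6 : 1 / μ ≤ 1 / (F.card * a) := by gcongr
  linarith

/-! ### Lower tails of the binomial distribution. -/

/-- The probability that a binomial variable with parameters `k` and `p` is less than `r`. -/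
noncomputable def lowDegreeProb (k r : ℕ) (p : ℝ) : ℝ :=
  ∑ j ∈ Finset.range (k + 1), if j < r then k.choose j * (p ^ j * (1 - p) ^ (k - j)) else 0

theorem one_sub_lowDegreeProb (k r : ℕ) (p : ℝ) :
    1 - lowDegreeProb k r p = ∑ j ∈ Finset.range (k + 1),
      if r ≤ j then k.choose j * (p ^ j * (1 - p) ^ (k - j)) else 0 := by
  have h : (1 : ℝ) = ∑ j ∈ Finset.range (k + 1), k.choose j * (p ^ j * (1 - p) ^ (k - j)) := by
    have := add_pow p (1 - p) k
    rw [add_sub_cancel, one_pow] at this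
    exact this.trans (Finset.sum_congr rfl fun j _ => by ring)
  rw [lowDegreeProb, sub_eq_iff_eq_add, ← Finset.sum_add_distrib]
  refine h.trans (Finset.sum_congr rfl fun j _ => ?_)
  by_cases hj : j < r
  · simp [hj, not_le.2 hj]
  · simp [hj, not_lt.1 hj]

theorem lowDegreeProb_self (r : ℕ) (p : ℝ) : lowDegreeProb r r p = 1 - p ^ r := by
  have := one_sub_lowDegreeProb r r p
  rw [Finset.sum_eq_single r] at this
  · simp at this
    linarith
  · intro j hj hjr
    rw [if_neg]
    have := Finset.mem_range.1 hj
    omega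
  · simp

theorem one_sub_lowDegreeProb_nonneg (k r : ℕ) {p : ℝ} (h0 : 0 ≤ p) (h1 : p ≤ 1) :
    0 ≤ 1 - lowDegreeProb k r p := by
  rw [one_sub_lowDegreeProb]
  have : 0 ≤ 1 - p := by linarith
  exact Finset.sum_nonneg fun j _ => by split_ifs <;> positivity

/-- Each term with j ≥ r is at most its binomial coefficient times p^r, and the coefficients sum to
2^k. -/
theorem one_sub_lowDegreeProb_le (k r : ℕ) {p : ℝ} (h0 : 0 ≤ p) (h1 : p ≤ 1) :
    1 - lowDegreeProb k r p ≤ 2 ^ k * p ^ r := by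
  rw [one_sub_lowDegreeProb]
  have h2 : (2 : ℝ) ^ k = ∑ j ∈ Finset.range (k + 1), (k.choose j : ℝ) := by
    exact_mod_cast (Nat.sum_range_choose k).symm
  rw [h2, Finset.sum_mul]
  refine Finset.sum_le_sum fun j _ => ?_
  split_ifs with h
  · refine mul_le_mul_of_nonneg_left ?_ (by positivity)
    calc p ^ j * (1 - p) ^ (k - j) ≤ p ^ j * 1 := by
          refine mul_le_mul_of_nonneg_left (pow_le_one₀ ?_ ?_) (by positivity) <;> linarith
      _ ≤ p ^ r := by rw [mul_one]; exact pow_le_pow_of_le_one h0 h1 h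
  · positivity

/-! ### Neighbours of one vertex in one or two sets. -/

variable {V : Type*}

/-- The edges joining `v` to the elements of `X`. -/
def starEdges [DecidableEq V] (v : V) (X : Finset V) : Finset (Sym2 V) := X.image fun x => s(v, x)

theorem mem_starEdges [DecidableEq V] {v x : V} {X : Finset V} : s(v, x) ∈ starEdges v X ↔ x ∈ X := by
  simp only [starEdges, Finset.mem_image, Sym2.congr_right, exists_eq_right]

theorem starEdges_subset [DecidableEq V] {v : V} {X Y : Finset V} (h : X ⊆ Y) : starEdges v X ⊆ starEdges v Y := by
  exact Finset.image_subset_image h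

theorem card_starEdges [DecidableEq V] (v : V) (X : Finset V) : (starEdges v X).card = X.card :=
  Finset.card_image_of_injective _ fun _ _ h => Sym2.congr_right.1 h

theorem not_isDiag_of_mem_starEdges [DecidableEq V] {v : V} {X : Finset V} (hv : v ∉ X) {e : Sym2 V}
    (he : e ∈ starEdges v X) : ¬ e.IsDiag := by
  obtain ⟨x, hx, rfl⟩ := Finset.mem_image.1 he
  rw [Sym2.mk_isDiag_iff]
  rintro rfl
  exact hv hx

theorem disjoint_starEdges [DecidableEq V] {u v : V} {X : Finset V} (huv : u ≠ v) (hv : v ∉ X) :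
    Disjoint (starEdges u X) (starEdges v X) := by
  rw [Finset.disjoint_left]
  intro e hu hv'
  obtain ⟨x, hx, rfl⟩ := Finset.mem_image.1 hu
  obtain ⟨y, hy, h⟩ := Finset.mem_image.1 hv'
  rcases Sym2.eq_iff.1 h with ⟨h, -⟩ | ⟨h, -⟩
  · exact huv h.symm
  · exact hv (h ▸ hx)

open Classical in
/-- The event that `v` has fewer than `r` neighbours in `X`. -/
def fewNeighbors (r : ℕ) (X : Finset V) (v : V) : Set (SimpleGraph V) :=
  {G | {x ∈ X | G.Adj v x}.card < r}

theorem dependsOnEdges_fewNeighbors [DecidableEq V] (r : ℕ) {X Y : Finset V} (hXY : X ⊆ Y) (v : V) :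
    DependsOnEdges (fewNeighbors r X v) (starEdges v Y) := by
  classical
  intro G G' h
  have : {x ∈ X | G.Adj v x} = {x ∈ X | G'.Adj v x} := Finset.filter_congr fun x hx => by
    simpa using h s(v, x) (mem_starEdges.2 (hXY hx))
  simp only [fewNeighbors, Set.mem_ofPred_eq, this]

theorem real_fewNeighbors [Finite V] (r : ℕ) (X : Finset V) {v : V} (hv : v ∉ X) (p : I) :
    (binomialRandom V p).real (fewNeighbors r X v) = lowDegreeProb X.card r p := by
  classical
  have h1 : fewNeighbors r X v = ⋃ T ∈ X.powerset.filter (·.card < r),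
      {G : SimpleGraph V | ∀ e ∈ starEdges v X, e ∈ G.edgeSet ↔ e ∈ starEdges v T} := by
    ext G
    simp only [fewNeighbors, Set.mem_ofPred_eq, Set.mem_iUnion, Finset.mem_filter,
      Finset.mem_powerset, exists_prop]
    constructor
    · intro h
      refine ⟨{x ∈ X | G.Adj v x}, ⟨Finset.filter_subset _ _, by convert h⟩, ?_⟩
      intro e he
      obtain ⟨x, hx, rfl⟩ := Finset.mem_image.1 he
      simp [mem_starEdges, hx]
    · rintro ⟨T, ⟨hT, hTr⟩, h⟩
      convert hTr using 2
      ext x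
      simp only [Finset.mem_filter]
      constructor
      · rintro ⟨hx, hvx⟩
        exact mem_starEdges.1 ((h s(v, x) (mem_starEdges.2 hx)).1 hvx)
      · intro hx
        exact ⟨hT hx, (h s(v, x) (mem_starEdges.2 (hT hx))).2 (mem_starEdges.2 hx)⟩
  rw [h1, measureReal_biUnion_finset]
  · have h2 : ∀ T ∈ X.powerset.filter (·.card < r), (binomialRandom V p).real
        {G : SimpleGraph V | ∀ e ∈ starEdges v X, e ∈ G.edgeSet ↔ e ∈ starEdges v T} =
        (p : ℝ) ^ T.card * (1 - p : ℝ) ^ (X.card - T.card) := by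
      intro T hT
      rw [real_edges_eq p _ _ (starEdges_subset (Finset.mem_powerset.1 (Finset.mem_filter.1 hT).1))
        (fun e he => not_isDiag_of_mem_starEdges hv he), card_starEdges, card_starEdges]
    rw [Finset.sum_congr rfl h2, Finset.sum_filter]
    have := Finset.sum_powerset_apply_card
      (fun j => if j < r then (p : ℝ) ^ j * (1 - p : ℝ) ^ (X.card - j) else 0) (x := X)
    rw [this, lowDegreeProb]
    refine Finset.sum_congr rfl fun j _ => ?_
    split_ifs <;> simp
  · intro T hT T' hT' hne
    rw [Function.onFun, Set.disjoint_left]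
    intro G hG hG'
    refine hne (Finset.ext fun x => ?_)
    have hTX := Finset.mem_powerset.1 (Finset.mem_filter.1 hT).1
    have hTX' := Finset.mem_powerset.1 (Finset.mem_filter.1 hT').1
    by_cases hx : x ∈ X
    · rw [← mem_starEdges (v := v), ← hG _ (mem_starEdges.2 hx), hG' _ (mem_starEdges.2 hx),
        mem_starEdges]
    · exact iff_of_false (fun h => hx (hTX h)) fun h => hx (hTX' h)
  · exact fun _ _ => measurableSet_of_finite _

/-- Inclusion-exclusion gives 2g - 1 plus the probability that both events fail, and 2g - 1 ≤ g². If
both fail, v has at least r + 1 neighbours in X ∪ Y; a union bound over at most 4^k sets of size r +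
1 finishes. -/
theorem real_fewNeighbors_inter_le [Finite V] {r : ℕ} {X Y : Finset V} {k : ℕ} (hX : X.card = k)
    (hY : Y.card = k) [DecidableEq V] (hXY : (X ∩ Y).card < r) {v : V} (hvX : v ∉ X) (hvY : v ∉ Y)
    (p : I) :
    (binomialRandom V p).real (fewNeighbors r X v ∩ fewNeighbors r Y v) ≤
      lowDegreeProb k r p ^ 2 + 4 ^ k * (p : ℝ) ^ (r + 1) := by
  classical
  set P := binomialRandom V p
  have hA : P.real (fewNeighbors r X v) = lowDegreeProb k r p := by
    rw [real_fewNeighbors r X hvX, hX]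
  have hB : P.real (fewNeighbors r Y v) = lowDegreeProb k r p := by
    rw [real_fewNeighbors r Y hvY, hY]
  have h1 := measureReal_union_add_inter (μ := P) (s := fewNeighbors r X v)
    (measurableSet_of_finite (fewNeighbors r Y v))
  have h2 := probReal_compl_eq_one_sub (μ := P)
    (measurableSet_of_finite (fewNeighbors r X v ∪ fewNeighbors r Y v))
  have hsub : (fewNeighbors r X v ∪ fewNeighbors r Y v)ᶜ ⊆
      ⋃ T ∈ (X ∪ Y).powerset.filter (·.card = r + 1),
        {G : SimpleGraph V | ∀ e ∈ starEdges v T, e ∈ G.edgeSet} := by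
    intro G hG
    simp only [fewNeighbors, Set.mem_compl_iff, Set.mem_union, not_or, Set.mem_ofPred_eq,
      not_lt] at hG
    obtain ⟨hGX, hGY⟩ := hG
    set NX := {x ∈ X | G.Adj v x} with hNX
    set NY := {x ∈ Y | G.Adj v x} with hNY
    have hcard : r + 1 ≤ (NX ∪ NY).card := by
      -- With only r neighbours in total, the two neighbour sets would coincide and lie in X ∩ Y,
      -- which is too small.
      by_contra! hlt
      have e1 : NX = NX ∪ NY := Finset.eq_of_subset_of_card_le Finset.subset_union_left (by omega)
      have e2 : NY = NX ∪ NY := Finset.eq_of_subset_of_card_le Finset.subset_union_right (by omega)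
      have e3 : NX ⊆ X ∩ Y := Finset.subset_inter (Finset.filter_subset _ _)
        ((e1.trans e2.symm) ▸ Finset.filter_subset _ _)
      have := Finset.card_le_card e3
      omega
    obtain ⟨T, hT, hTc⟩ := Finset.exists_subset_card_eq hcard
    refine Set.mem_biUnion (x := T) ?_ ?_
    · simp only [Finset.coe_filter, Finset.mem_powerset, Set.mem_ofPred_eq]
      exact ⟨hT.trans (Finset.union_subset_union (Finset.filter_subset _ _)
        (Finset.filter_subset _ _)), hTc⟩
    · intro e he
      obtain ⟨x, hx, rfl⟩ := Finset.mem_image.1 he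
      have := hT hx
      simp only [hNX, hNY, Finset.mem_union, Finset.mem_filter] at this
      rcases this with h | h <;> exact h.2
  have h3 : P.real (fewNeighbors r X v ∪ fewNeighbors r Y v)ᶜ ≤ 4 ^ k * (p : ℝ) ^ (r + 1) := by
    refine (measureReal_mono hsub (measure_ne_top _ _)).trans ((measureReal_biUnion_finset_le _ _).trans ?_)
    have h4 : ∀ T ∈ (X ∪ Y).powerset.filter (·.card = r + 1),
        P.real {G : SimpleGraph V | ∀ e ∈ starEdges v T, e ∈ G.edgeSet} = (p : ℝ) ^ (r + 1) := by
      intro T hT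
      rw [Finset.mem_filter, Finset.mem_powerset] at hT
      have hvT : v ∉ T := fun h => by
        rcases Finset.mem_union.1 (hT.1 h) with h | h
        exacts [hvX h, hvY h]
      rw [real_subset_edgeSet p _ (fun e he => not_isDiag_of_mem_starEdges hvT he), card_starEdges,
        hT.2]
    rw [Finset.sum_congr rfl h4, Finset.sum_const, nsmul_eq_mul]
    refine mul_le_mul_of_nonneg_right ?_ (pow_nonneg p.2.1 _)
    have h5 : ((X ∪ Y).powerset.filter (·.card = r + 1)).card ≤ 4 ^ k := by
      refine (Finset.card_filter_le _ _).trans ?_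
      rw [Finset.card_powerset]
      calc 2 ^ (X ∪ Y).card ≤ 2 ^ (2 * k) := by
            refine Nat.pow_le_pow_right (by norm_num) ?_
            have := Finset.card_union_le X Y
            omega
        _ = 4 ^ k := by rw [pow_mul]; norm_num
    exact_mod_cast h5
  nlinarith [sq_nonneg (1 - lowDegreeProb k r p)]

/-! ### First and second moments of the obstruction count. -/

/-- The event that the colouring obstruction is witnessed by `X` and `w`. -/
def sparseEvent (r : ℕ) (X : Finset V) (w : V) : Set (SimpleGraph V) :=
  {G | (∀ u ∈ insert w (X : Set V), ∀ v ∈ insert w (X : Set V), ¬ G.Adj u v) ∧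
    ∀ v ∉ insert w (X : Set V), G ∈ fewNeighbors r X v}

theorem card_lt_treeCoverNumber_of_mem_sparseEvent [Finite V] {r : ℕ} (hr : 2 ≤ r) {X : Finset V} {w : V}
    (hw : w ∉ X) {G : SimpleGraph V} (hG : G ∈ sparseEvent r X w) :
    X.card < treeCoverNumber r G := by
  classical
  obtain ⟨h1, h2⟩ := hG
  refine card_lt_treeCoverNumber hr G X w hw (fun v hv => ?_) fun v hv x hx =>
    h1 v (by simpa using hv) x (by simp [hx])
  by_cases hvw : v = w
  · subst hvw
    rw [Finset.filter_false_of_mem fun x hx => h1 v (by simp) x (by simp [hx])]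
    simp
    omega
  · have h3 := h2 v (by simp [hvw, hv])
    simp only [fewNeighbors, Set.mem_ofPred_eq] at h3
    convert h3

/-- The pairs inside X ∪ {w} and the stars from the remaining vertices to X are disjoint edge sets,
so the probabilities multiply. Both exponents are rounded up, which is harmless for bases in [0, 1].
-/
theorem le_real_sparseEvent [Fintype V] (r : ℕ) {X : Finset V} {w : V} (p : I) :
    (1 - p : ℝ) ^ ((X.card + 2) ^ 2) * lowDegreeProb X.card r p ^ Fintype.card V ≤
      (binomialRandom V p).real (sparseEvent r X w) := by
  classical
  set P := binomialRandom V p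
  have hp0 : 0 ≤ (p : ℝ) := p.2.1
  have hp1 : (p : ℝ) ≤ 1 := p.2.2
  set g := lowDegreeProb X.card r p
  let U := insert w X
  let S : Finset (Sym2 V) := U.sym2.filter (¬ ·.IsDiag)
  let A : Set (SimpleGraph V) := {G | ∀ e ∈ S, e ∉ G.edgeSet}
  let B : Set (SimpleGraph V) := ⋂ v ∈ Uᶜ, fewNeighbors r X v
  have hsub : A ∩ B ⊆ sparseEvent r X w := by
    rintro G ⟨hA, hB⟩
    refine ⟨fun u hu v hv huv => ?_, fun v hv => ?_⟩
    · refine hA s(u, v) ?_ huv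
      simp only [S, Finset.mem_filter, Finset.mk_mem_sym2_iff, Sym2.mk_isDiag_iff]
      exact ⟨⟨by simpa [U] using hu, by simpa [U] using hv⟩, huv.ne⟩
    · exact Set.mem_iInter₂.1 hB v (by simpa [U] using hv)
  have hdepA : DependsOnEdges A S := fun G G' h =>
    forall₂_congr fun e he => not_congr (h e he)
  have hdepB : DependsOnEdges B (Uᶜ.biUnion fun v => starEdges v X) := by
    intro G G' h
    simp only [B, Set.mem_iInter]
    exact forall₂_congr fun v hv => dependsOnEdges_fewNeighbors r subset_rfl v G G' fun e he =>
      h e (Finset.mem_biUnion.2 ⟨v, hv, he⟩)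
  have hdisj : Disjoint S (Uᶜ.biUnion fun v => starEdges v X) := by
    rw [Finset.disjoint_left]
    intro e he he'
    obtain ⟨v, hv, he'⟩ := Finset.mem_biUnion.1 he'
    obtain ⟨x, hx, rfl⟩ := Finset.mem_image.1 he'
    exact Finset.mem_compl.1 hv (Finset.mk_mem_sym2_iff.1 (Finset.mem_filter.1 he).1).1
  have hX (v) (hv : v ∈ Uᶜ) : v ∉ X := fun h =>
    Finset.mem_compl.1 hv (Finset.mem_insert_of_mem h)
  have hPB : P.real B = g ^ Uᶜ.card := by
    rw [real_biInter_of_dependsOnEdges Uᶜ _ (fun v => starEdges v X)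
      (fun v _ => dependsOnEdges_fewNeighbors r subset_rfl v)
      (fun u _ v hv huv => disjoint_starEdges huv (hX v hv))]
    rw [Finset.prod_congr rfl fun v hv => real_fewNeighbors r X (hX v hv) p, Finset.prod_const]
  have hPA : P.real A = (1 - p : ℝ) ^ S.card :=
    real_disjoint_edgeSet p S fun e he => (Finset.mem_filter.1 he).2
  have hg1 : g ≤ 1 := by linarith [one_sub_lowDegreeProb_nonneg X.card r hp0 hp1]
  have hg0 : 0 ≤ g := by
    rw [show g = lowDegreeProb X.card r p from rfl, lowDegreeProb]
    have : 0 ≤ 1 - (p : ℝ) := by linarith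
    exact Finset.sum_nonneg fun j _ => by split_ifs <;> positivity
  have hS : S.card ≤ (X.card + 2) ^ 2 := by
    refine (Finset.card_filter_le _ _).trans ?_
    rw [Finset.card_sym2, Nat.choose_two_right]
    have : U.card ≤ X.card + 1 := Finset.card_insert_le w X
    refine (Nat.div_le_self _ _).trans ?_
    rw [sq]
    exact Nat.mul_le_mul (by omega) (by omega)
  calc _ ≤ (1 - p : ℝ) ^ S.card * g ^ Uᶜ.card := by
        refine mul_le_mul (pow_le_pow_of_le_one (by linarith) (by linarith) hS)
          (pow_le_pow_of_le_one hg0 hg1 (Finset.card_le_univ _)) (by positivity)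
          (pow_nonneg (by linarith) _)
    _ = P.real (A ∩ B) := by rw [hdepA.real_inter hdepB hdisj, hPA, hPB]
    _ ≤ _ := measureReal_mono hsub

/-- Dropping every condition on the at most 2k + 1 vertices of X ∪ Y ∪ {w} leaves independent
events, one per remaining vertex. The loss is a bounded power of g, negligible as g → 1. -/
theorem real_sparseEvent_inter_le [Fintype V] [DecidableEq V] {r k : ℕ} {X Y : Finset V} {w : V}
    (hX : X.card = k) (hY : Y.card = k) (hXY : (X ∩ Y).card < r) (p : I)
    (hg : 0 < lowDegreeProb k r p) (hV : 2 * k + 1 ≤ Fintype.card V) :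
    (binomialRandom V p).real (sparseEvent r X w ∩ sparseEvent r Y w) ≤
      lowDegreeProb k r p ^ (2 * (Fintype.card V - (2 * k + 1))) *
        (1 + 4 ^ k * (p : ℝ) ^ (r + 1) / lowDegreeProb k r p ^ 2) ^ Fintype.card V := by
  classical
  set P := binomialRandom V p
  have hp0 : 0 ≤ (p : ℝ) := p.2.1
  have hp1 : (p : ℝ) ≤ 1 := p.2.2
  set g := lowDegreeProb k r p
  have hg1 : g ≤ 1 := by linarith [one_sub_lowDegreeProb_nonneg k r hp0 hp1]
  set s : ℝ := 4 ^ k * (p : ℝ) ^ (r + 1)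
  let U := insert w (X ∪ Y)
  have hU : U.card ≤ 2 * k + 1 := by
    have h1 := Finset.card_insert_le w (X ∪ Y)
    have h2 := Finset.card_union_le X Y
    change (insert w (X ∪ Y)).card ≤ _
    omega
  have hUc : Fintype.card V - (2 * k + 1) ≤ Uᶜ.card := by
    rw [Finset.card_compl]
    omega
  have hsub : sparseEvent r X w ∩ sparseEvent r Y w ⊆
      ⋂ v ∈ Uᶜ, (fewNeighbors r X v ∩ fewNeighbors r Y v) := by
    rintro G ⟨⟨-, h1⟩, -, h2⟩
    refine Set.mem_iInter₂.2 fun v hv => ?_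
    simp only [U, Finset.mem_compl, Finset.mem_insert, Finset.mem_union, not_or] at hv
    exact ⟨h1 v (by simp [hv]), h2 v (by simp [hv])⟩
  have hXYv (v) (hv : v ∈ Uᶜ) : v ∉ X ∪ Y := fun h =>
    Finset.mem_compl.1 hv (Finset.mem_insert_of_mem h)
  refine (measureReal_mono hsub).trans ?_
  rw [real_biInter_of_dependsOnEdges Uᶜ (fun v => fewNeighbors r X v ∩ fewNeighbors r Y v)
    (fun v => starEdges v (X ∪ Y)) (fun v _ G G' h => and_congr
      (dependsOnEdges_fewNeighbors r Finset.subset_union_left v G G' h)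
      (dependsOnEdges_fewNeighbors r Finset.subset_union_right v G G' h))
    (fun u _ v hv huv => disjoint_starEdges huv (hXYv v hv))]
  calc ∏ v ∈ Uᶜ, P.real (fewNeighbors r X v ∩ fewNeighbors r Y v)
      ≤ ∏ v ∈ Uᶜ, (g ^ 2 * (1 + s / g ^ 2)) := by
        refine Finset.prod_le_prod (fun _ _ => measureReal_nonneg) fun v hv => ?_
        have hv' := hXYv v hv
        rw [Finset.mem_union, not_or] at hv'
        refine (real_fewNeighbors_inter_le hX hY hXY hv'.1 hv'.2 p).trans (le_of_eq ?_)
        field_simp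
        rfl
    _ = g ^ (2 * Uᶜ.card) * (1 + s / g ^ 2) ^ Uᶜ.card := by
        rw [Finset.prod_const, mul_pow, pow_mul]
    _ ≤ _ := by
        have hs : 0 ≤ s / g ^ 2 := by positivity
        refine mul_le_mul (pow_le_pow_of_le_one hg.le hg1 (by omega))
          (pow_le_pow_right₀ (by linarith) (Finset.card_le_univ _)) (by positivity) (by positivity)

end

/-! ### Sparse families and the limiting criterion. -/

section

open MeasureTheory ProbabilityTheory unitInterval Filter Topology

/-- A family of `k`-sets avoiding a vertex `w`, any two of which share fewer than `r` elements. -/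
structure IsSparseFamily {V : Type*} [DecidableEq V] (k r : ℕ) (w : V) (F : Finset (Finset V)) :
    Prop where
  card_eq : ∀ X ∈ F, X.card = k
  notMem : ∀ X ∈ F, w ∉ X
  card_inter_lt : ∀ X ∈ F, ∀ Y ∈ F, X ≠ Y → (X ∩ Y).card < r

theorem IsSparseFamily.le_real_lt_treeCoverNumber {V : Type*} [Fintype V] [DecidableEq V]
    {k r : ℕ} (hr : 2 ≤ r) {w : V} {F : Finset (Finset V)} (hF : IsSparseFamily k r w F)
    (hne : F.Nonempty) (p : I) (hp : (p : ℝ) < 1) (hg : 0 < lowDegreeProb k r p)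
    (hV : 2 * k + 1 ≤ Fintype.card V) :
    2 - 1 / (F.card * lowDegreeProb k r p ^ Fintype.card V * (1 - p : ℝ) ^ ((k + 2) ^ 2)) -
      Real.exp (Fintype.card V * (p : ℝ) ^ (r + 1) * (4 ^ k / lowDegreeProb k r p ^ 2)) /
        ((1 - p : ℝ) ^ (2 * (k + 2) ^ 2) * lowDegreeProb k r p ^ (2 * (2 * k + 1))) ≤
      (binomialRandom V p).real {G | k < treeCoverNumber r G} := by
  set P := binomialRandom V p
  set g := lowDegreeProb k r p
  set n := Fintype.card V
  have hp' : 0 < 1 - (p : ℝ) := by linarith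
  have hp0 : 0 ≤ (p : ℝ) := p.2.1
  have hs0 : 0 ≤ 4 ^ k * (p : ℝ) ^ (r + 1) / g ^ 2 := by positivity
  have h := real_compl_biUnion_le_of_pairwise P F hne (fun X => sparseEvent r X w)
    (fun _ => measurableSet_of_finite _)
    (a := (1 - p : ℝ) ^ ((k + 2) ^ 2) * g ^ n)
    (b := g ^ (2 * (n - (2 * k + 1))) * (1 + 4 ^ k * (p : ℝ) ^ (r + 1) / g ^ 2) ^ n)
    (by positivity) (by positivity)
    (fun X hX => by
      have := le_real_sparseEvent r (X := X) (w := w) p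
      rwa [hF.card_eq X hX] at this)
    (fun X hX Y hY hXY => real_sparseEvent_inter_le (hF.card_eq X hX) (hF.card_eq Y hY)
      (hF.card_inter_lt X hX Y hY hXY) p hg hV)
  have h1 : 1 - P.real {G | k < treeCoverNumber r G} ≤
      P.real (⋃ X ∈ F, sparseEvent r X w)ᶜ := by
    rw [probReal_compl_eq_one_sub (measurableSet_of_finite _)]
    refine sub_le_sub_left (measureReal_mono ?_) 1
    refine Set.iUnion₂_subset fun X hX G hG => ?_
    have := card_lt_treeCoverNumber_of_mem_sparseEvent hr (hF.notMem X hX) hG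
    rwa [hF.card_eq X hX] at this
  have h2 : g ^ (2 * (n - (2 * k + 1))) * (1 + 4 ^ k * (p : ℝ) ^ (r + 1) / g ^ 2) ^ n /
      ((1 - p : ℝ) ^ ((k + 2) ^ 2) * g ^ n) ^ 2 ≤
      Real.exp (n * (p : ℝ) ^ (r + 1) * (4 ^ k / g ^ 2)) /
        ((1 - p : ℝ) ^ (2 * (k + 2) ^ 2) * g ^ (2 * (2 * k + 1))) := by
    have e1 : ((1 - p : ℝ) ^ ((k + 2) ^ 2) * g ^ n) ^ 2 = g ^ (2 * (n - (2 * k + 1))) *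
        ((1 - p : ℝ) ^ (2 * (k + 2) ^ 2) * g ^ (2 * (2 * k + 1))) := by
      have : n * 2 = 2 * (n - (2 * k + 1)) + 2 * (2 * k + 1) := by omega
      rw [mul_pow, ← pow_mul, ← pow_mul, this, pow_add, mul_comm _ 2]
      ring
    rw [e1, mul_div_mul_left _ _ (by positivity)]
    refine div_le_div_of_nonneg_right ?_ (by positivity)
    calc _ ≤ Real.exp (4 ^ k * (p : ℝ) ^ (r + 1) / g ^ 2) ^ n := by
          refine pow_le_pow_left₀ (by linarith) ?_ _
          rw [add_comm]
          exact Real.add_one_le_exp _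
      _ = _ := by
          rw [← Real.exp_nat_mul]
          congr 1
          ring
  have h3 : F.card * ((1 - p : ℝ) ^ ((k + 2) ^ 2) * g ^ n) =
      F.card * g ^ n * (1 - p : ℝ) ^ ((k + 2) ^ 2) := by ring
  rw [h3] at h
  linarith

/-- Here g → 1 because p → 0. Divergence of M g^n removes the first-moment term, and n p^(r+1) → 0
sends the correlation ratio to 1, so the lower bound tends to 2 - 0 - 1. -/
theorem tendsto_real_lt_treeCoverNumber {k r : ℕ} (hr : 2 ≤ r) (p : ℕ → I) (M : ℕ → ℕ)
    (hF : ∀ᶠ n in atTop, ∃ w : Fin n, ∃ F, IsSparseFamily k r w F ∧ F.card = M n)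
    (hp : Tendsto (fun n => (p n : ℝ)) atTop (𝓝 0))
    (hnp : Tendsto (fun n : ℕ => n * (p n : ℝ) ^ (r + 1)) atTop (𝓝 0))
    (hM : Tendsto (fun n => M n * lowDegreeProb k r (p n) ^ n) atTop atTop) :
    Tendsto (fun n => binomialRandom (Fin n) (p n) {G | k < treeCoverNumber r G})
      atTop (𝓝 1) := by
  have hg : Tendsto (fun n => lowDegreeProb k r (p n)) atTop (𝓝 1) := by
    have h1 : Tendsto (fun n => 1 - lowDegreeProb k r (p n)) atTop (𝓝 0) := by
      refine squeeze_zero (fun n => one_sub_lowDegreeProb_nonneg k r (p n).2.1 (p n).2.2)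
        (fun n => one_sub_lowDegreeProb_le k r (p n).2.1 (p n).2.2) ?_
      have := (hp.pow r).const_mul (2 ^ k)
      rwa [zero_pow (by omega), mul_zero] at this
    simpa using h1.const_sub 1
  have hp1 : Tendsto (fun n => 1 - (p n : ℝ)) atTop (𝓝 1) := by simpa using hp.const_sub 1
  have hlim : Tendsto (fun n : ℕ =>
      2 - 1 / (M n * lowDegreeProb k r (p n) ^ n * (1 - p n : ℝ) ^ ((k + 2) ^ 2)) -
      Real.exp (n * (p n : ℝ) ^ (r + 1) * (4 ^ k / lowDegreeProb k r (p n) ^ 2)) /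
        ((1 - p n : ℝ) ^ (2 * (k + 2) ^ 2) * lowDegreeProb k r (p n) ^ (2 * (2 * k + 1))))
      atTop (𝓝 1) := by
    have hA : Tendsto (fun n : ℕ =>
        1 / (M n * lowDegreeProb k r (p n) ^ n * (1 - p n : ℝ) ^ ((k + 2) ^ 2))) atTop (𝓝 0) := by
      simp only [one_div]
      refine tendsto_inv_atTop_zero.comp ?_
      exact hM.atTop_mul_pos one_pos (by simpa using hp1.pow ((k + 2) ^ 2))
    have hB : Tendsto (fun n : ℕ =>
        Real.exp (n * (p n : ℝ) ^ (r + 1) * (4 ^ k / lowDegreeProb k r (p n) ^ 2)) /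
        ((1 - p n : ℝ) ^ (2 * (k + 2) ^ 2) * lowDegreeProb k r (p n) ^ (2 * (2 * k + 1))))
        atTop (𝓝 1) := by
      have e := hnp.mul ((tendsto_const_nhds (x := (4 : ℝ) ^ k)).div (hg.pow 2) (by simp))
      have := ((Real.continuous_exp.tendsto _).comp e).div
        ((hp1.pow (2 * (k + 2) ^ 2)).mul (hg.pow (2 * (2 * k + 1)))) (by simp)
      simpa [Function.comp_def, Pi.div_def] using this
    have := (hA.const_sub 2).sub hB
    norm_num at this
    simpa using this
  have hreal : Tendsto (fun n => (binomialRandom (Fin n) (p n)).real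
      {G | k < treeCoverNumber r G}) atTop (𝓝 1) := by
    refine tendsto_of_tendsto_of_tendsto_of_le_of_le' hlim tendsto_const_nhds ?_
      (Eventually.of_forall fun n => measureReal_le_one)
    filter_upwards [hF, hp.eventually_lt_const one_pos, hg.eventually_const_lt one_pos,
      hM.eventually_gt_atTop 0, eventually_ge_atTop (2 * k + 1)] with n ⟨w, F, hF, hFM⟩ h1 h2 h3 h4
    have hne : F.Nonempty := by
      rw [← Finset.card_pos, hFM]
      by_contra h
      simp [Nat.eq_zero_of_not_pos h] at h3
    have := hF.le_real_lt_treeCoverNumber hr hne (p n) h1 h2 (by simpa using h4)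
    rwa [Fintype.card_fin, hFM] at this
  rw [← ENNReal.tendsto_toReal_iff (fun n => measure_ne_top _ _) ENNReal.one_ne_top]
  simpa [measureReal_def] using hreal

theorem isSparseFamily_powersetCard {V : Type*} [Fintype V] [DecidableEq V] (r : ℕ) (w : V) :
    IsSparseFamily r r w ((Finset.univ.erase w).powersetCard r) where
  card_eq X hX := (Finset.mem_powersetCard.1 hX).2
  notMem X hX h := by simpa using (Finset.mem_powersetCard.1 hX).1 h
  card_inter_lt X hX Y hY hXY := by
    have hX' := (Finset.mem_powersetCard.1 hX).2
    have hY' := (Finset.mem_powersetCard.1 hY).2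
    by_contra! h
    exact hXY ((Finset.eq_of_subset_of_card_le Finset.inter_subset_left (by omega)).symm.trans
      (Finset.eq_of_subset_of_card_le Finset.inter_subset_right (by omega)))

theorem exists_isSparseFamily_blocks {k r n : ℕ} (hk : 0 < k) (hr : 0 < r) (hn : 0 < n) :
    ∃ w : Fin n, ∃ F, IsSparseFamily k r w F ∧ F.card = (n - 1) / k := by
  let B : ℕ → Finset (Fin n) := fun i => {v : Fin n | (v : ℕ) / k = i}
  have hB (i : ℕ) (v : Fin n) : v ∈ B i ↔ (v : ℕ) / k = i := by simp [B]
  have hcard (i : ℕ) (hi : i < (n - 1) / k) : (B i).card = k := by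
    have hlt (j : ℕ) (hj : j < k) : k * i + j < n := by
      have h1 := Nat.mul_le_mul_left k (Nat.succ_le_of_lt hi)
      have h2 := Nat.mul_div_le (n - 1) k
      rw [Nat.succ_eq_add_one, mul_add] at h1
      omega
    have := Finset.card_bij (s := Finset.range k) (t := B i)
      (fun j hj => ⟨k * i + j, hlt j (Finset.mem_range.1 hj)⟩)
      (fun j hj => by
        rw [hB, Nat.mul_add_div hk, Nat.div_eq_of_lt (Finset.mem_range.1 hj), add_zero])
      (fun a _ b _ h => by simpa using h)
      (fun v hv => ⟨v % k, Finset.mem_range.2 (Nat.mod_lt _ hk), Fin.ext (by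
        have := Nat.div_add_mod v k
        rw [(hB i v).1 hv] at this
        exact this)⟩)
    rw [← this, Finset.card_range]
  -- The full blocks of consecutive integers fit into the first n - 1 values, so the last vertex
  -- lies in none of them.
  refine ⟨⟨n - 1, by omega⟩, (Finset.range ((n - 1) / k)).image B, ⟨?_, ?_, ?_⟩, ?_⟩
  · intro X hX
    obtain ⟨i, hi, rfl⟩ := Finset.mem_image.1 hX
    exact hcard i (Finset.mem_range.1 hi)
  · intro X hX h
    obtain ⟨i, hi, rfl⟩ := Finset.mem_image.1 hX
    exact (Finset.mem_range.1 hi).ne' ((hB i _).1 h)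
  · intro X hX Y hY hXY
    obtain ⟨i, hi, rfl⟩ := Finset.mem_image.1 hX
    obtain ⟨j, hj, rfl⟩ := Finset.mem_image.1 hY
    have : B i ∩ B j = ∅ := by
      rw [← Finset.disjoint_iff_inter_eq_empty, Finset.disjoint_left]
      intro v hi hj
      exact hXY (by rw [← (hB i v).1 hi, ← (hB j v).1 hj])
    simpa [this] using hr
  · rw [Finset.card_image_of_injOn, Finset.card_range]
    intro i hi j hj hij
    have hi' : 0 < (B i).card := by
      rw [hcard i (Finset.mem_range.1 hi)]
      exact hk
    obtain ⟨v, hv⟩ := Finset.card_pos.1 hi'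
    rw [← (hB i v).1 hv, ← (hB j v).1 (by rw [← show B i = B j from hij]; exact hv)]

/-! ### Asymptotic estimates in the two regimes. -/

theorem tendsto_zero_of_pow {x : ℕ → ℝ} {r : ℕ} (hr : r ≠ 0) (hx : ∀ n, 0 ≤ x n)
    (h : Tendsto (fun n => x n ^ r) atTop (𝓝 0)) : Tendsto x atTop (𝓝 0) := by
  have h1 := h.rpow_const (p := (r : ℝ)⁻¹) (Or.inr (by positivity))
  rw [Real.zero_rpow (by positivity)] at h1
  exact h1.congr fun n => Real.pow_rpow_inv_natCast (hx n) hr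

theorem tendsto_mul_log_pow_div (c : ℝ) (m : ℕ) :
    Tendsto (fun n : ℕ => (c * Real.log n) ^ m / n) atTop (𝓝 0) := by
  have h := (Real.isLittleO_pow_log_id_atTop (n := m)).tendsto_div_nhds_zero.comp
    tendsto_natCast_atTop_atTop
  have := h.const_mul (c ^ m)
  rw [mul_zero] at this
  exact this.congr fun n => by simp [mul_pow, mul_div_assoc]

/-- The identity (n p^(r+1))^r · n = (n p^r)^(r+1) bounds the r-th power of n p^(r+1) by a power of
log n divided by n. -/
theorem tendsto_zero_of_mul_pow_le {r : ℕ} (hr : 2 ≤ r) {p : ℕ → I}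
    (h : ∀ᶠ n : ℕ in atTop, n * (p n : ℝ) ^ r ≤ r * Real.log n) :
    Tendsto (fun n => (p n : ℝ)) atTop (𝓝 0) ∧
      Tendsto (fun n : ℕ => n * (p n : ℝ) ^ (r + 1)) atTop (𝓝 0) := by
  have hp0 (n : ℕ) : 0 ≤ (p n : ℝ) := (p n).2.1
  constructor
  · refine tendsto_zero_of_pow (r := r) (by omega) hp0 ?_
    refine squeeze_zero' (Eventually.of_forall fun n => pow_nonneg (hp0 n) _) ?_
      (tendsto_mul_log_pow_div r 1)
    filter_upwards [h, eventually_gt_atTop 0] with n hn hpos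
    have : (0 : ℝ) < n := by exact_mod_cast hpos
    rw [le_div_iff₀ this, pow_one, mul_comm]
    exact hn
  · refine tendsto_zero_of_pow (r := r) (by omega)
      (fun n => mul_nonneg n.cast_nonneg (pow_nonneg (hp0 n) _)) ?_
    refine squeeze_zero' (Eventually.of_forall fun n =>
      pow_nonneg (mul_nonneg n.cast_nonneg (pow_nonneg (hp0 n) _)) _) ?_
      (tendsto_mul_log_pow_div r (r + 1))
    filter_upwards [h, eventually_gt_atTop 0] with n hn hpos
    have : (0 : ℝ) < n := by exact_mod_cast hpos
    have hn0 : 0 ≤ n * (p n : ℝ) ^ r := mul_nonneg n.cast_nonneg (pow_nonneg (hp0 n) _)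
    rw [le_div_iff₀ this]
    calc (n * (p n : ℝ) ^ (r + 1)) ^ r * n = (n * (p n : ℝ) ^ r) ^ (r + 1) := by ring
      _ ≤ _ := pow_le_pow_left₀ hn0 hn _

theorem exp_neg_le_one_sub_pow {q : ℝ} (h1 : q ≤ 1 / 2) (n : ℕ) :
    Real.exp (-(n * q) - 2 * (n * q ^ 2)) ≤ (1 - q) ^ n := by
  have hpos : 0 < 1 - q := by linarith
  have h2 : -q - 2 * q ^ 2 ≤ Real.log (1 - q) := by
    refine le_trans ?_ (Real.one_sub_inv_le_log_of_pos hpos)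
    have : 1 - (1 - q)⁻¹ = -q / (1 - q) := by
      field_simp
      ring
    rw [this, le_div_iff₀ hpos]
    nlinarith [sq_nonneg q]
  have h3 : Real.exp (-q - 2 * q ^ 2) ≤ 1 - q := by
    rwa [← Real.le_log_iff_exp_le hpos]
  calc Real.exp (-(n * q) - 2 * (n * q ^ 2)) = Real.exp (-q - 2 * q ^ 2) ^ n := by
        rw [← Real.exp_nat_mul]
        congr 1
        ring
    _ ≤ _ := pow_le_pow_left₀ (Real.exp_pos _).le h3 _

theorem tendsto_lt_treeCoverNumber_of_log_sub {r : ℕ} (hr : 2 ≤ r) (p : ℕ → I) (ω : ℕ → ℝ)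
    (hω : Tendsto ω atTop atTop)
    (hp : ∀ᶠ n : ℕ in atTop, n * (p n : ℝ) ^ r = r * Real.log n - ω n) :
    Tendsto (fun n => binomialRandom (Fin n) (p n) {G | r < treeCoverNumber r G})
      atTop (𝓝 1) := by
  have hle : ∀ᶠ n : ℕ in atTop, n * (p n : ℝ) ^ r ≤ r * Real.log n := by
    filter_upwards [hp, hω.eventually_ge_atTop 0] with n h1 h2
    linarith
  obtain ⟨hp0, hnp⟩ := tendsto_zero_of_mul_pow_le hr hle
  refine tendsto_real_lt_treeCoverNumber hr p (fun n => (n - 1).choose r) ?_ hp0 hnp ?_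
  · filter_upwards [eventually_gt_atTop 0] with n hn
    refine ⟨⟨0, hn⟩, _, isSparseFamily_powersetCard r _, ?_⟩
    simp [Finset.card_powersetCard]
  -- The factor 2^r r! comes from C(n-1, r) ≥ (n/2)^r / r!, and the -1 from 2 n q² ≤ 1 with q = p^r.
  · have hlim : Tendsto (fun n => (2 ^ r * r.factorial : ℝ)⁻¹ * Real.exp (ω n + -1)) atTop atTop :=
      (Real.tendsto_exp_atTop.comp (tendsto_atTop_add_const_right _ _ hω)).const_mul_atTop
        (by positivity)
    refine tendsto_atTop_mono' _ ?_ hlim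
    have hsmall := (tendsto_mul_log_pow_div r 2).eventually_le_const (show (0 : ℝ) < 1 / 2 by norm_num)
    have hpr : Tendsto (fun n => (p n : ℝ) ^ r) atTop (𝓝 0) := by
      simpa [show r ≠ 0 by omega] using hp0.pow r
    filter_upwards [hp, hle, hsmall, eventually_ge_atTop (2 * r + 1),
      hpr.eventually_le_const (show (0 : ℝ) < 1 / 2 by norm_num)] with n h1 h2 h3 h4 h5
    have hn : (0 : ℝ) < n := by exact_mod_cast (by omega : 0 < n)
    set q := (p n : ℝ) ^ r with hq
    have hq0 : 0 ≤ q := pow_nonneg (p n).2.1 _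
    have hnq : n * q ^ 2 ≤ 1 / 2 := by
      refine le_trans ?_ h3
      rw [le_div_iff₀ hn]
      calc n * q ^ 2 * n = (n * q) ^ 2 := by ring
        _ ≤ _ := pow_le_pow_left₀ (by positivity) h2 _
    have hg : Real.exp (ω n + -1) / n ^ r ≤ lowDegreeProb r r (p n) ^ n := by
      rw [lowDegreeProb_self]
      refine le_trans (le_of_eq ?_) ((Real.exp_le_exp.2 (show ω n + -1 - r * Real.log n ≤
        -(n * q) - 2 * (n * q ^ 2) by linarith)).trans (exp_neg_le_one_sub_pow h5 n))
      rw [Real.exp_sub, Real.exp_nat_mul, Real.exp_log hn]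
    have hM : (n / 2 : ℝ) ^ r / r.factorial ≤ (n - 1).choose r := by
      rw [div_le_iff₀ (by positivity), mul_comm]
      have h6 : (n - r) ^ r ≤ r.factorial * (n - 1).choose r := by
        rw [← Nat.descFactorial_eq_factorial_mul_choose]
        have := Nat.pow_sub_le_descFactorial (n - 1) r
        rwa [show n - 1 + 1 - r = n - r by omega] at this
      calc (n / 2 : ℝ) ^ r ≤ ((n - r : ℕ) : ℝ) ^ r := by
            refine pow_le_pow_left₀ (by positivity) ?_ _
            rw [Nat.cast_sub (by omega)]
            have : (2 * r + 1 : ℝ) ≤ n := by exact_mod_cast h4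
            linarith
        _ ≤ _ := by exact_mod_cast h6
    calc (2 ^ r * r.factorial : ℝ)⁻¹ * Real.exp (ω n + -1)
        = (n / 2 : ℝ) ^ r / r.factorial * (Real.exp (ω n + -1) / n ^ r) := by
          rw [div_pow]
          field_simp
      _ ≤ _ := mul_le_mul hM hg (by positivity) (by positivity)

theorem tendsto_lt_treeCoverNumber_of_isLittleO {r k : ℕ} (hr : 2 ≤ r) (hk : 0 < k) (p : ℕ → I)
    (hp : ∀ c : ℝ, 0 < c → ∀ᶠ n : ℕ in atTop, n * (p n : ℝ) ^ r ≤ c * Real.log n) :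
    Tendsto (fun n => binomialRandom (Fin n) (p n) {G | k < treeCoverNumber r G})
      atTop (𝓝 1) := by
  obtain ⟨hp0, hnp⟩ := tendsto_zero_of_mul_pow_le hr (hp r (by positivity))
  refine tendsto_real_lt_treeCoverNumber hr p (fun n => (n - 1) / k) ?_ hp0 hnp ?_
  · filter_upwards [eventually_gt_atTop 0] with n hn
    exact exists_isSparseFamily_blocks hk (by omega) hn
  · have hlim : Tendsto (fun n : ℕ => (2 * k : ℝ)⁻¹ * Real.exp ((2 : ℝ)⁻¹ * Real.log n))
        atTop atTop :=
      (Real.tendsto_exp_atTop.comp ((Real.tendsto_log_atTop.comp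
        tendsto_natCast_atTop_atTop).const_mul_atTop (by positivity))).const_mul_atTop
        (by positivity)
    refine tendsto_atTop_mono' _ ?_ hlim
    have hpr : Tendsto (fun n => 2 ^ k * (p n : ℝ) ^ r) atTop (𝓝 0) := by
      simpa [show r ≠ 0 by omega] using (hp0.pow r).const_mul (2 ^ k)
    -- This constant gives n q ≤ (log n) / 4. As 2 n q² ≤ n q, the total exponent loss is at most
    -- (log n) / 2, so M g^n is at least √n / (2k).
    filter_upwards [hp (1 / (4 * 2 ^ k)) (by positivity), eventually_ge_atTop (2 * k + 2),
      hpr.eventually_le_const (show (0 : ℝ) < 1 / 2 by norm_num)] with n h1 h2 h3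
    have hn : (0 : ℝ) < n := by exact_mod_cast (by omega : 0 < n)
    have hk' : (0 : ℝ) < k := by exact_mod_cast hk
    set q := 1 - lowDegreeProb k r (p n) with hq
    have hq0 : 0 ≤ q := one_sub_lowDegreeProb_nonneg k r (p n).2.1 (p n).2.2
    have hq1 : q ≤ 2 ^ k * (p n : ℝ) ^ r := one_sub_lowDegreeProb_le k r (p n).2.1 (p n).2.2
    have hnq : n * q ≤ Real.log n / 4 := by
      calc n * q ≤ n * (2 ^ k * (p n : ℝ) ^ r) := by gcongr
        _ = 2 ^ k * (n * (p n : ℝ) ^ r) := by ring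
        _ ≤ 2 ^ k * (1 / (4 * 2 ^ k) * Real.log n) := by gcongr
        _ = _ := by field_simp
    have hnq2 : n * q ^ 2 ≤ n * q / 2 := by
      have : n * q * q ≤ n * q * (1 / 2) :=
        mul_le_mul_of_nonneg_left (hq1.trans h3) (by positivity)
      linarith [show n * q ^ 2 = n * q * q by ring]
    have hg : Real.exp ((2 : ℝ)⁻¹ * Real.log n) / n ≤ lowDegreeProb k r (p n) ^ n := by
      have := exp_neg_le_one_sub_pow (hq1.trans h3) n
      rw [show 1 - q = lowDegreeProb k r (p n) by rw [hq]; ring] at this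
      refine le_trans (le_of_eq ?_) ((Real.exp_le_exp.2 (show (2 : ℝ)⁻¹ * Real.log n - Real.log n ≤
        -(n * q) - 2 * (n * q ^ 2) by linarith)).trans this)
      rw [Real.exp_sub, Real.exp_log hn]
    have hM : (n / (2 * k) : ℝ) ≤ ((n - 1) / k : ℕ) := by
      rw [div_le_iff₀ (by positivity)]
      have h6 : n ≤ (n - 1) / k * (2 * k) := by
        have := Nat.div_add_mod (n - 1) k
        have := Nat.mod_lt (n - 1) hk
        have e : (n - 1) / k * (2 * k) = 2 * (k * ((n - 1) / k)) := by ring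
        omega
      exact_mod_cast h6
    calc (2 * k : ℝ)⁻¹ * Real.exp ((2 : ℝ)⁻¹ * Real.log n)
        = n / (2 * k) * (Real.exp ((2 : ℝ)⁻¹ * Real.log n) / n) := by
          field_simp
      _ ≤ _ := mul_le_mul hM hg (by positivity) (by positivity)

end

end SimpleGraph

/-! ### Translation from p to n p^r. -/

theorem theorem1p5 (r : ℕ) (hr : 2 ≤ r) :
    (∀ (p : ℕ → unitInterval) (ω : ℕ → ℝ),
      Filter.Tendsto ω Filter.atTop Filter.atTop →
      (∀ᶠ n : ℕ in Filter.atTop, ω n ≤ (r : ℝ) * Real.log (n : ℝ)) →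
      (∀ᶠ n : ℕ in Filter.atTop,
        (p n : ℝ) = (((r : ℝ) * Real.log (n : ℝ) - ω n) / (n : ℝ)) ^ (1 / (r : ℝ))) →
      Filter.Tendsto
        (fun n : ℕ => SimpleGraph.binomialRandom (Fin n) (p n)
          {G : SimpleGraph (Fin n) | r < SimpleGraph.treeCoverNumber r G})
        Filter.atTop (nhds 1)) ∧
    (∀ p : ℕ → unitInterval,
      Asymptotics.IsLittleO Filter.atTop (fun n : ℕ => (p n : ℝ))
        (fun n : ℕ => ((r : ℝ) * Real.log (n : ℝ) / (n : ℝ)) ^ (1 / (r : ℝ))) →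
      ∀ K : ℕ, Filter.Tendsto
        (fun n : ℕ => SimpleGraph.binomialRandom (Fin n) (p n)
          {G : SimpleGraph (Fin n) | K < SimpleGraph.treeCoverNumber r G})
        Filter.atTop (nhds 1)) := by
  have hr0 : r ≠ 0 := by omega
  have hr' : (0 : ℝ) < r := by positivity
  refine ⟨fun p ω hω hle hp => ?_, fun p hp K => ?_⟩
  · refine SimpleGraph.tendsto_lt_treeCoverNumber_of_log_sub hr p ω hω ?_
    filter_upwards [hle, hp, Filter.eventually_gt_atTop 0] with n h1 h2 h3
    have hn : (0 : ℝ) < n := by exact_mod_cast h3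
    rw [h2, one_div, Real.rpow_inv_natCast_pow (div_nonneg (by linarith) hn.le) hr0]
    field_simp
  -- Using K + 1 instead of K keeps the block size positive. The little-o constant (c/r)^(1/r)
  -- becomes c/r after taking r-th powers, which cancels the r in r log n.
  · have hlim := SimpleGraph.tendsto_lt_treeCoverNumber_of_isLittleO hr K.succ_pos p fun c hc => by
      filter_upwards [hp.bound (show 0 < (c / r) ^ (r : ℝ)⁻¹ by positivity),
        Filter.eventually_gt_atTop 0] with n h1 h2
      have hn : (0 : ℝ) < n := by exact_mod_cast h2
      have hx : 0 ≤ (r : ℝ) * Real.log n / n :=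
        div_nonneg (mul_nonneg hr'.le (Real.log_natCast_nonneg n)) hn.le
      rw [Real.norm_of_nonneg (p n).2.1, Real.norm_of_nonneg (Real.rpow_nonneg hx _), one_div] at h1
      calc n * (p n : ℝ) ^ r
          ≤ n * ((c / r) ^ (r : ℝ)⁻¹ * (r * Real.log n / n) ^ (r : ℝ)⁻¹) ^ r :=
            mul_le_mul_of_nonneg_left (pow_le_pow_left₀ (p n).2.1 h1 r) hn.le
        _ = n * (c / r * (r * Real.log n / n)) := by
            rw [mul_pow, Real.rpow_inv_natCast_pow (by positivity) hr0,
              Real.rpow_inv_natCast_pow hx hr0]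
        _ = c * Real.log n := by field_simp
    exact tendsto_of_tendsto_of_tendsto_of_le_of_le hlim tendsto_const_nhds
      (fun n => MeasureTheory.measure_mono fun G hG => (Nat.lt_succ_self K).trans hG)
      fun n => MeasureTheory.prob_le_one
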